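/- Let $R$ be a ring (associative, with unit; for instance a commutative coherent ring). Write $R\text{-}\mathrm{fpmod}$ for the category of finitely presented left $R$-modules. For an Ab-category $\mathbf{A}$, a functor $F : \mathbf{A} \to \mathbf{Ab}$ is called finitely presented if there is a morphism $\alpha : X \to Y$ in $\mathbf{A}$ and an exact sequence $\operatorname{Hom}(Y,-) \xrightarrow{(\alpha,-)} \operatorname{Hom}(X,-) \to F \to 0$; $\mathrm{fp}(\mathbf{A},\mathbf{Ab})$ denotes the category of all such functors and all natural transformations between them. Let $\mathcal{C}(R)$ be the Ab-category with a single object whose morphisms are the elements of $R$, where $r$ followed by $s$ is the product $rs$. For an Ab-category $\mathbf{A}$, let $\mathbf{A}^{\oplus}$ be its additive closure: objects are finite families $(A_1,\dots,A_m)$, $m \ge 0$, of objects of $\mathbf{A}$, morphisms $(A_i) \to (B_j)$ are matrices of morphisms $A_i \to B_j$, and composition is matrix multiplication. For an additive category $\mathbf{A}$, let $\mathcal{A}(\mathbf{A})$ be its Freyd category: objects are morphisms $(A \xleftarrow{\rho_A} R_A)$ of $\mathbf{A}$; a morphism from $(A \xleftarrow{\rho_A} R_A)$ to $(B \xleftarrow{\rho_B}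 R_B)$ is represented by a morphism $\alpha : A \to B$ such that $\alpha \circ \rho_A = \rho_B \circ \rho_\alpha$ for some $\rho_\alpha : R_A \to R_B$; two such $\alpha, \alpha'$ are identified if $\alpha - \alpha' = \rho_B \circ \lambda$ for some $\lambda : A \to R_B$; composition and identities are inherited from $\mathbf{A}$. Then there are equivalences of categories \[ R\text{-}\mathrm{fpmod} \simeq \mathcal{A}\big(\mathcal{C}(R)^{\oplus}\big) \qquad\text{and}\qquad \mathrm{fp}\big(R\text{-}\mathrm{fpmod}, \mathbf{Ab}\big) \simeq \mathcal{A}\big(\mathcal{A}(\mathcal{C}(R)^{\oplus})^{\mathrm{op}}\big). \] -/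

import Mathlib

open CategoryTheory CategoryTheory.Limits CategoryTheory.Preadditive Opposite

universe v u

/-- The category `R`-fpmod of finitely presented left `R`-modules, as a full subcategory of the
category of all left `R`-modules. -/
abbrev FPModuleCat (R : Type u) [Ring R] : Type (u + 1) :=
  ObjectProperty.FullSubcategory
    (fun M : ModuleCat.{u} R => Module.FinitePresentation R M)

/-- A ring `R` regarded as an Ab-category with a single object, whose morphisms are the elements of
`R`, where `r` followed by `s` is the product `r * s`. (In `SingleObj M` the composite
`x ≫ y` is `y * x`, hence the opposite ring.) -/
abbrev RingAsCategory (R : Type u) [Ring R] : Type :=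
  SingleObj Rᵐᵒᵖ

/-- The additive closure of an Ab-category: objects are finite families of objects,
morphisms are matrices of morphisms. -/
abbrev AdditiveClosure (A : Type u) [Category.{v} A] [Preadditive A] : Type (max u 1) :=
  Mat_ A

/-- The Freyd category of `A`: an object is a morphism `ρ : R_A ⟶ A'` of `A` (thought of as its
cokernel), a morphism from `ρ : R_A ⟶ A'` to `σ : R_B ⟶ B'` is a morphism `α : A' ⟶ B'` for
which some `R_A ⟶ R_B` completes a commutative square, and `α`, `α'` are identified when `α - α'`
factors through `σ`. In `Arrow A`, `A'` is the right and `R_A` the left object, and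
`RightFreyd A` is the quotient of `Arrow A` by this relation. -/
abbrev FreydCategory (A : Type u) [Category.{v} A] [Preadditive A] : Type (max u v) :=
  RightFreyd A

/-- A covariant functor `F` on `A` with values in abelian groups is finitely presented if there are
a morphism `α : X ⟶ Y` of `A` and an exact sequence `(Y, -) ⟶ (X, -) ⟶ F ⟶ 0`, the first map
being `(α, -)`; that is, `F` is a cokernel of a morphism between representable functors. -/
def IsFinitelyPresentedFunctor {A : Type u} [Category.{v} A] [Preadditive A]
    (F : A ⥤ AddCommGrpCat.{v}) : Prop :=
  ∃ (X Y : A) (α : X ⟶ Y) (p : preadditiveCoyoneda.obj (op X) ⟶ F)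
    (w : preadditiveCoyoneda.map α.op ≫ p = 0),
    Nonempty (IsColimit (CokernelCofork.ofπ p w))

/-- Finitely presented functors are additive, so `fp(A, Ab)` is a full subcategory of the category
of additive functors. -/
theorem IsFinitelyPresentedFunctor.additive {A : Type u} [Category.{v} A] [Preadditive A]
    {F : A ⥤ AddCommGrpCat.{v}} (hF : IsFinitelyPresentedFunctor F) : F.Additive := by
  obtain ⟨X, Y, α, p, w, ⟨h⟩⟩ := hF
  have hp : Epi p := epi_of_isColimit_cofork h
  have hp' : ∀ Z, Epi (p.app Z) := (NatTrans.epi_iff_epi_app p).1 hp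
  refine ⟨fun {Z W f g} => ?_⟩
  rw [← cancel_epi (p.app Z), ← p.naturality, Functor.map_add, add_comp, comp_add,
    p.naturality, p.naturality]

/-- The category `fp(A, Ab)` of finitely presented functors from `A` to abelian groups, with all
natural transformations as morphisms. -/
abbrev FPFunctorCat (A : Type u) [Category.{v} A] [Preadditive A] : Type (max u (v + 1)) :=
  ObjectProperty.FullSubcategory
    (fun F : A ⥤ AddCommGrpCat.{v} => IsFinitelyPresentedFunctor F)

/-!
Let `G : V ⥤ D` be fully faithful and additive, with `D` abelian. Sending an arrow `ρ` of `V` to the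
cokernel of `G.map ρ` identifies homotopic morphisms of arrows, hence defines a functor from the
Freyd category of `V` to `D`. If morphisms from values of `G` lift along epimorphisms out of values
of `G`, then, as in the comparison of projective resolutions, morphisms between cokernels lift to
morphisms of presentations, uniquely up to homotopy. So the Freyd category is equivalent to the full
subcategory of the cokernels.

For the functor from matrices over `R` to free modules the cokernels are the finitely presented
modules. For the Yoneda embedding of `Aᵒᵖ` they are the finitely presented functors on `A`, and the
lifting property is the additive Yoneda lemma. The second equivalence is the latter case for
`A = R`-fpmod, with `A` replaced by the equivalent Freyd category of the first.
-/

namespace FreydCategory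

section Lift

variable {V : Type*} [Category* V] [Preadditive V] {D : Type*} [Category* D]

/-- The functor on the Freyd category induced by a functor on arrows which identifies homotopic
morphisms. -/
def lift (F : Arrow V ⥤ D)
    (hF : ∀ ⦃a b : Arrow V⦄ (f g : a ⟶ b), Arrow.RightHomotopy f g → F.map f = F.map g) :
    FreydCategory V ⥤ D :=
  CategoryTheory.Quotient.lift _ F fun _ _ f g ⟨h⟩ => hF f g h

variable (F : Arrow V ⥤ D)
  (hF : ∀ ⦃a b : Arrow V⦄ (f g : a ⟶ b), Arrow.RightHomotopy f g → F.map f = F.map g)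

theorem quotient_comp_lift : RightFreyd.quotient V ⋙ lift F hF = F :=
  CategoryTheory.Quotient.lift_spec _ _ _

theorem essImage_lift : (lift F hF).essImage = F.essImage := by
  rw [← Functor.essImage_comp_of_essSurj (F := RightFreyd.quotient V), quotient_comp_lift]

instance [F.EssSurj] : (lift F hF).EssSurj where
  mem_essImage Y := by
    rw [essImage_lift]
    exact Functor.EssSurj.mem_essImage F Y

instance [F.Full] : (lift F hF).Full :=
  Functor.full_of_comp_essSurj _ (RightFreyd.quotient V) fun _ _ φ =>
    let ⟨f, hf⟩ := F.map_surjective φ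
    ⟨(RightFreyd.quotient V).map f, hf⟩

instance [Preadditive D] [F.Additive] : (lift F hF).Additive :=
  have : (RightFreyd.quotient V ⋙ lift F hF).Additive := by rwa [quotient_comp_lift]
  Functor.additive_of_full_essSurj_comp (RightFreyd.quotient V) _

theorem faithful_lift
    (hF' : ∀ ⦃a b : Arrow V⦄ (f g : a ⟶ b), F.map f = F.map g →
      Nonempty (Arrow.RightHomotopy f g)) :
    (lift F hF).Faithful :=
  Functor.faithful_of_comp_essSurj _ (RightFreyd.quotient V) fun X Y f g hfg => by
    obtain ⟨f, rfl⟩ := (RightFreyd.quotient V).map_surjective f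
    obtain ⟨g, rfl⟩ := (RightFreyd.quotient V).map_surjective g
    exact (RightFreyd.quotient_map_eq_iff f g).2 (hF' f g hfg)

end Lift

section Map

variable {V : Type*} [Category* V] [Preadditive V] {W : Type*} [Category* W] [Preadditive W]

theorem nonempty_rightHomotopy_mapArrow_iff (F : V ⥤ W) [F.Additive] [F.Full] [F.Faithful]
    {a b : Arrow V} (f g : a ⟶ b) :
    Nonempty (Arrow.RightHomotopy (F.mapArrow.map f) (F.mapArrow.map g)) ↔
      Nonempty (Arrow.RightHomotopy f g) := by
  constructor
  · rintro ⟨h⟩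
    obtain ⟨k, hk⟩ := F.map_surjective (X := a.right) (Y := b.left) h.hom
    refine ⟨⟨k, F.map_injective ?_⟩⟩
    rw [F.map_sub, F.map_comp, hk]
    exact h.comm
  · rintro ⟨h⟩
    refine ⟨⟨F.map h.hom, ?_⟩⟩
    refine Eq.trans ?_ (F.map_comp _ _)
    rw [← h.comm, F.map_sub]
    rfl

/-- The equivalence of Freyd categories induced by an additive equivalence. -/
noncomputable def congr (F : V ⥤ W) [F.Additive] [F.IsEquivalence] :
    FreydCategory V ≌ FreydCategory W :=
  have homotopic_iff {a b : Arrow V} (f g : a ⟶ b) :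
      (F.mapArrow ⋙ RightFreyd.quotient W).map f = (F.mapArrow ⋙ RightFreyd.quotient W).map g ↔
        Nonempty (Arrow.RightHomotopy f g) :=
    (RightFreyd.quotient_map_eq_iff _ _).trans (nonempty_rightHomotopy_mapArrow_iff F f g)
  let L := lift (F.mapArrow ⋙ RightFreyd.quotient W) fun _ _ f g h => (homotopic_iff f g).2 ⟨h⟩
  have : L.Faithful := faithful_lift _ _ fun _ _ f g => (homotopic_iff f g).1
  have : L.IsEquivalence := {}
  L.asEquivalence

end Map

section Cokernel

variable {V : Type*} [Category* V] {D : Type*} [Category* D]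

/-- `G` has relatively projective values if its values are projective relative to the epimorphisms
out of values of `G`. This is weaker than having projective values: a representable functor lifts
along epimorphisms `F ⟶ F'` with `F` additive, but not along arbitrary ones. -/
class HasRelativelyProjectiveValues (G : V ⥤ D) : Prop where
  exists_lift {X Y : V} {Z : D} (p : G.obj Y ⟶ Z) [Epi p] (f : G.obj X ⟶ Z) :
    ∃ g : G.obj X ⟶ G.obj Y, g ≫ p = f

instance (G : V ⥤ D) [∀ X, Projective (G.obj X)] : HasRelativelyProjectiveValues G where
  exists_lift p _ f := ⟨Projective.factorThru f p, Projective.factorThru_comp f p⟩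

section HasCokernels

variable [HasZeroMorphisms D] [HasCokernels D] (G : V ⥤ D)

/-- The functor sending an arrow `ρ` to the cokernel of `G.map ρ`. -/
noncomputable abbrev cokernelOfMap : Arrow V ⥤ D :=
  G.mapArrow ⋙ coker D

/-- The projection onto the cokernel, typed so that its target is syntactically a value of
`cokernelOfMap G`. -/
noncomputable def cokernelOfMapπ (a : Arrow V) : G.obj a.right ⟶ (cokernelOfMap G).obj a :=
  cokernel.π (G.map a.hom)

instance (a : Arrow V) : Epi (cokernelOfMapπ G a) :=
  inferInstanceAs (Epi (cokernel.π (G.map a.hom)))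

theorem map_hom_comp_cokernelOfMapπ (a : Arrow V) : G.map a.hom ≫ cokernelOfMapπ G a = 0 :=
  cokernel.condition _

theorem cokernelOfMapπ_comp_map {a b : Arrow V} (f : a ⟶ b) :
    cokernelOfMapπ G a ≫ (cokernelOfMap G).map f = G.map f.right ≫ cokernelOfMapπ G b :=
  cokernel.π_desc _ _ _

theorem exists_map_comp_cokernelOfMapπ_eq [HasRelativelyProjectiveValues G] [G.Full]
    {W : V} {b : Arrow V} (f : G.obj W ⟶ (cokernelOfMap G).obj b) :
    ∃ g : W ⟶ b.right, G.map g ≫ cokernelOfMapπ G b = f := by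
  obtain ⟨g, hg⟩ := HasRelativelyProjectiveValues.exists_lift (cokernelOfMapπ G b) f
  exact ⟨G.preimage g, by rw [G.map_preimage, hg]⟩

end HasCokernels

section Additive

variable [Preadditive V] [Preadditive D] [HasCokernels D] (G : V ⥤ D) [G.Additive]

instance : (cokernelOfMap G).Additive where
  map_add {a b f g} := by
    rw [← cancel_epi (cokernelOfMapπ G a), comp_add, cokernelOfMapπ_comp_map,
      cokernelOfMapπ_comp_map, cokernelOfMapπ_comp_map, Arrow.Hom.add_right, G.map_add, add_comp]

theorem cokernelOfMap_map_eq_iff {a b : Arrow V} (f g : a ⟶ b) :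
    (cokernelOfMap G).map f = (cokernelOfMap G).map g ↔
      G.map (f.right - g.right) ≫ cokernelOfMapπ G b = 0 := by
  rw [← cancel_epi (cokernelOfMapπ G a), cokernelOfMapπ_comp_map, cokernelOfMapπ_comp_map,
    G.map_sub, sub_comp, sub_eq_zero]

theorem cokernelOfMap_map_eq_of_rightHomotopy {a b : Arrow V} {f g : a ⟶ b}
    (h : Arrow.RightHomotopy f g) : (cokernelOfMap G).map f = (cokernelOfMap G).map g := by
  rw [cokernelOfMap_map_eq_iff, h.comm, G.map_comp, Category.assoc, map_hom_comp_cokernelOfMapπ,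
    comp_zero]

/-- The functor on the Freyd category induced by `cokernelOfMap G`. -/
noncomputable def liftCokernel : FreydCategory V ⥤ D :=
  lift (cokernelOfMap G) fun _ _ _ _ => cokernelOfMap_map_eq_of_rightHomotopy G

instance : (liftCokernel G).Additive :=
  inferInstanceAs (lift _ _).Additive

theorem essImage_liftCokernel : (liftCokernel G).essImage = (cokernelOfMap G).essImage :=
  essImage_lift _ _

variable (P : ObjectProperty D) (hP : (cokernelOfMap G).essImage = P)

/-- The functor from the Freyd category to the full subcategory of cokernels of morphisms `G.map ρ`.
The property `P` is a parameter, so that the target can be a full subcategory described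
differently. -/
noncomputable def liftCokernelFullSubcategory : FreydCategory V ⥤ P.FullSubcategory :=
  P.lift (liftCokernel G) fun X => by
    rw [← hP, ← essImage_liftCokernel]
    exact Functor.obj_mem_essImage _ X

instance : (liftCokernelFullSubcategory G P hP).Additive where
  map_add := P.ι.map_injective (liftCokernel G).map_add

instance : (liftCokernelFullSubcategory G P hP).EssSurj where
  mem_essImage Y := by
    obtain ⟨X, ⟨e⟩⟩ : (liftCokernel G).essImage Y.obj := by
      rw [essImage_liftCokernel, hP]
      exact Y.property
    exact ⟨X, ⟨P.isoMk e⟩⟩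

end Additive

variable [Abelian D] (G : V ⥤ D) [HasRelativelyProjectiveValues G] [G.Full]

theorem exists_comp_hom_eq_of_map_comp_cokernelOfMapπ_eq_zero [G.Faithful] {W : V} {b : Arrow V}
    (g : W ⟶ b.right) (hg : G.map g ≫ cokernelOfMapπ G b = 0) :
    ∃ h : W ⟶ b.left, h ≫ b.hom = g := by
  -- In an abelian category the kernel of the cokernel is the image, onto which `G.obj b.left` maps
  -- epimorphically.
  obtain ⟨h, hh⟩ := HasRelativelyProjectiveValues.exists_lift
    (Abelian.factorThruImage (G.map b.hom)) (kernel.lift (cokernel.π (G.map b.hom)) (G.map g) hg)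
  refine ⟨G.preimage h, G.map_injective ?_⟩
  rw [G.map_comp, G.map_preimage, ← Abelian.image.fac (G.map b.hom), reassoc_of% hh]
  exact kernel.lift_ι _ _ hg

instance [G.Faithful] : (cokernelOfMap G).Full where
  map_surjective {a b} φ := by
    obtain ⟨r, hr⟩ := exists_map_comp_cokernelOfMapπ_eq G (cokernelOfMapπ G a ≫ φ)
    obtain ⟨l, comm⟩ := exists_comp_hom_eq_of_map_comp_cokernelOfMapπ_eq_zero G (a.hom ≫ r) (by
      rw [G.map_comp, Category.assoc, hr, reassoc_of% map_hom_comp_cokernelOfMapπ G a, zero_comp])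
    refine ⟨Arrow.homMk l r comm, ?_⟩
    rw [← cancel_epi (cokernelOfMapπ G a), cokernelOfMapπ_comp_map, ← hr]
    rfl

variable [Preadditive V] [G.Additive] [G.Faithful]

theorem nonempty_rightHomotopy_of_cokernelOfMap_map_eq {a b : Arrow V} {f g : a ⟶ b}
    (hfg : (cokernelOfMap G).map f = (cokernelOfMap G).map g) :
    Nonempty (Arrow.RightHomotopy f g) := by
  rw [cokernelOfMap_map_eq_iff] at hfg
  obtain ⟨h, hh⟩ := exists_comp_hom_eq_of_map_comp_cokernelOfMapπ_eq_zero G _ hfg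
  exact ⟨⟨h, hh.symm⟩⟩

instance : (liftCokernel G).Full :=
  inferInstanceAs (lift _ _).Full

instance : (liftCokernel G).Faithful :=
  faithful_lift _ _ fun _ _ _ _ => nonempty_rightHomotopy_of_cokernelOfMap_map_eq G

instance (P : ObjectProperty D) (hP : (cokernelOfMap G).essImage = P) :
    (liftCokernelFullSubcategory G P hP).IsEquivalence where
  full := inferInstanceAs (P.lift (liftCokernel G) _).Full
  faithful := inferInstanceAs (P.lift (liftCokernel G) _).Faithful

end Cokernel

end FreydCategory

namespace FPFunctorCat

variable {A : Type u} [Category.{v} A] [Preadditive A]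

theorem coyoneda_app_apply {X : Aᵒᵖ} {F : A ⥤ AddCommGrpCat.{v}}
    (f : preadditiveCoyoneda.obj X ⟶ F) {Z : A} (x : X.unop ⟶ Z) :
    f.app Z x = F.map x (f.app X.unop (𝟙 X.unop)) := by
  have naturality := ConcreteCategory.congr_hom (f.naturality x) (𝟙 X.unop)
  have map_id : (preadditiveCoyoneda.obj X).map x (𝟙 X.unop) = x := Category.id_comp x
  exact (congrArg (f.app Z) map_id).symm.trans naturality

theorem coyoneda_hom_ext {X : Aᵒᵖ} {F : A ⥤ AddCommGrpCat.{v}}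
    {f g : preadditiveCoyoneda.obj X ⟶ F}
    (h : f.app X.unop (𝟙 X.unop) = g.app X.unop (𝟙 X.unop)) : f = g := by
  ext Z x
  exact (coyoneda_app_apply f x).trans
    ((congrArg (F.map _) h).trans (coyoneda_app_apply g x).symm)

/-- The natural transformation which corresponds to `s` by the additive Yoneda lemma. Its components
are homomorphisms because `F` is additive. -/
def coyonedaLift {X : Aᵒᵖ} {F : A ⥤ AddCommGrpCat.{v}} [F.Additive] (s : F.obj X.unop) :
    preadditiveCoyoneda.obj X ⟶ F where
  app Z := AddCommGrpCat.ofHom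
    { toFun x := F.map (X := X.unop) x s
      map_zero' := ConcreteCategory.congr_hom (F.map_zero X.unop Z) s
      map_add' _ _ := ConcreteCategory.congr_hom (F.map_add (X := X.unop)) s }
  naturality Z W h := by
    ext x
    exact ConcreteCategory.congr_hom (F.map_comp (X := X.unop) x h) s

theorem coyonedaLift_app_id {X : Aᵒᵖ} {F : A ⥤ AddCommGrpCat.{v}} [F.Additive]
    (s : F.obj X.unop) : (coyonedaLift s).app X.unop (𝟙 X.unop) = s :=
  ConcreteCategory.congr_hom (F.map_id X.unop) s

instance : (preadditiveCoyoneda : Aᵒᵖ ⥤ A ⥤ AddCommGrpCat.{v}).Additive where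
  map_add {X Y f g} := by
    ext Z x
    exact add_comp _ _ _ f.unop g.unop x

theorem exists_lift_of_coyoneda {X : Aᵒᵖ} {F F' : A ⥤ AddCommGrpCat.{v}} [F.Additive]
    (p : F ⟶ F') [Epi p] (f : preadditiveCoyoneda.obj X ⟶ F') :
    ∃ g : preadditiveCoyoneda.obj X ⟶ F, g ≫ p = f := by
  have p_surjective : Function.Surjective (p.app X.unop) :=
    (AddCommGrpCat.epi_iff_surjective _).1 ((NatTrans.epi_iff_epi_app p).1 inferInstance _)
  obtain ⟨s, hs⟩ := p_surjective (f.app X.unop (𝟙 X.unop))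
  refine ⟨coyonedaLift s, coyoneda_hom_ext ?_⟩
  exact (congrArg (p.app X.unop) (coyonedaLift_app_id s)).trans hs

instance : FreydCategory.HasRelativelyProjectiveValues
    (preadditiveCoyoneda : Aᵒᵖ ⥤ A ⥤ AddCommGrpCat.{v}) where
  exists_lift p _ f := exists_lift_of_coyoneda p f

theorem essImage_cokernelOfMap_preadditiveCoyoneda :
    (FreydCategory.cokernelOfMap (preadditiveCoyoneda : Aᵒᵖ ⥤ A ⥤ AddCommGrpCat.{v})).essImage =
      fun F => IsFinitelyPresentedFunctor F := by
  ext F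
  constructor
  · rintro ⟨a, ⟨e⟩⟩
    refine ⟨a.right.unop, a.left.unop, a.hom.unop,
      FreydCategory.cokernelOfMapπ preadditiveCoyoneda a ≫ e.hom, ?_, ⟨?_⟩⟩
    · exact (cokernel.condition_assoc (preadditiveCoyoneda.map a.hom) e.hom).trans zero_comp
    · exact IsColimit.ofIsoColimit (cokernelIsCokernel (preadditiveCoyoneda.map a.hom))
        (Cofork.ext e rfl)
  · rintro ⟨X, Y, α, p, w, ⟨h⟩⟩
    exact ⟨Arrow.mk α.op, ⟨(cokernelIsCokernel _).coconePointUniqueUpToIso h⟩⟩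

/-- Finitely presented functors are the Freyd category of the opposite category. -/
noncomputable def equivFreydCategory : FPFunctorCat A ≌ FreydCategory Aᵒᵖ :=
  (FreydCategory.liftCokernelFullSubcategory preadditiveCoyoneda _
    essImage_cokernelOfMap_preadditiveCoyoneda).asEquivalence.symm

end FPFunctorCat

namespace RingAsCategory

variable {R : Type u} [Ring R]

/-- A morphism of the additive closure as a matrix over `R`. Composition of morphisms is matrix
multiplication in the same order, since `SingleObj` and `Rᵐᵒᵖ` both reverse multiplication. -/
def toMatrix {X Y : AdditiveClosure (RingAsCategory R)} (f : X ⟶ Y) : Matrix X.ι Y.ι R :=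
  Matrix.of fun i j => MulOpposite.unop (f i j)

theorem toMatrix_bijective (X Y : AdditiveClosure (RingAsCategory R)) :
    Function.Bijective (toMatrix : (X ⟶ Y) → Matrix X.ι Y.ι R) :=
  Function.bijective_iff_has_inverse.2 ⟨fun M i j => MulOpposite.op (M i j), fun _ => rfl,
    fun _ => rfl⟩

theorem toMatrix_id (X : AdditiveClosure (RingAsCategory R)) [DecidableEq X.ι] :
    toMatrix (𝟙 X) = 1 := by
  ext i j
  by_cases h : i = j
  · subst h
    simp [toMatrix, SingleObj.id_as_one]
  · simp [toMatrix, h, Mat_.id_apply_of_ne]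

theorem toMatrix_comp {X Y Z : AdditiveClosure (RingAsCategory R)} (f : X ⟶ Y) (g : Y ⟶ Z) :
    toMatrix (f ≫ g) = toMatrix f * toMatrix g := by
  ext i j
  exact Finset.unop_sum _ _

variable (R)

/-- The functor sending a finite family of length `n` to `Rⁿ`, on which matrices act on row vectors
by right multiplication, as befits left modules. -/
noncomputable def rowVectors : AdditiveClosure (RingAsCategory R) ⥤ ModuleCat.{u} R where
  obj X := ModuleCat.of R (X.ι → R)
  map f := ModuleCat.ofHom (toMatrix f).vecMulLinear
  map_id X := by
    classical
    rw [toMatrix_id]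
    exact ModuleCat.hom_ext Matrix.toLinearMapRight'_one
  map_comp f g := by
    classical
    rw [toMatrix_comp]
    exact ModuleCat.hom_ext (Matrix.toLinearMapRight'_mul _ _)

instance : (rowVectors R).Additive where
  map_add {X Y f g} := by
    classical
    ext : 1
    exact map_add (Matrix.toLinearMapRight' (R := R)) (toMatrix f) (toMatrix g)

theorem rowVectors_map_bijective (X Y : AdditiveClosure (RingAsCategory R)) :
    Function.Bijective
      ((rowVectors R).map : (X ⟶ Y) → ((rowVectors R).obj X ⟶ (rowVectors R).obj Y)) := by
  classical
  exact (ModuleCat.homEquiv (M := (rowVectors R).obj X)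
    (N := (rowVectors R).obj Y)).symm.bijective.comp
    ((Matrix.toLinearMapRight' (R := R)).bijective.comp (toMatrix_bijective X Y))

instance : (rowVectors R).Full where
  map_surjective := (rowVectors_map_bijective R _ _).surjective

instance : (rowVectors R).Faithful where
  map_injective h := (rowVectors_map_bijective R _ _).injective h

instance (X : AdditiveClosure (RingAsCategory R)) : Projective ((rowVectors R).obj X) :=
  ModuleCat.projective_of_free (Pi.basisFun R X.ι)

variable {R}

theorem finitePresentation_cokernelOfMap_rowVectors
    (a : Arrow (AdditiveClosure (RingAsCategory R))) :
    Module.FinitePresentation R ((FreydCategory.cokernelOfMap (rowVectors R)).obj a) := by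
  let ρ := ((rowVectors R).map a.hom).hom
  have : Module.Finite R ((rowVectors R).obj a.left) :=
    inferInstanceAs (Module.Finite R (a.left.ι → R))
  have : Module.FinitePresentation R ((rowVectors R).obj a.right) :=
    inferInstanceAs (Module.FinitePresentation R (a.right.ι → R))
  have : Module.FinitePresentation R ((rowVectors R).obj a.right ⧸ LinearMap.range ρ) :=
    Module.finitePresentation_of_surjective (LinearMap.range ρ).mkQ
      (Submodule.mkQ_surjective _) (by
        rw [Submodule.ker_mkQ]
        exact Module.Finite.iff_fg.1 (Module.Finite.range ρ))
  let e := ModuleCat.cokernelIsoRangeQuotient ((rowVectors R).map a.hom)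
  exact Module.FinitePresentation.of_equiv e.toLinearEquiv.symm

theorem essImage_cokernelOfMap_rowVectors_of_finitePresentation (M : ModuleCat.{u} R)
    [Module.FinitePresentation R M] :
    (FreydCategory.cokernelOfMap (rowVectors R)).essImage M := by
  obtain ⟨n, m, f, g, hf, hfg⟩ := Module.FinitePresentation.exists_fin' R M
  let X : AdditiveClosure (RingAsCategory R) := ⟨Fin m, fun _ => SingleObj.star _⟩
  let Y : AdditiveClosure (RingAsCategory R) := ⟨Fin n, fun _ => SingleObj.star _⟩
  obtain ⟨ρ, hρ⟩ := (rowVectors R).map_surjective (X := X) (Y := Y) (ModuleCat.ofHom g)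
  let e : ((Fin n → R) ⧸ LinearMap.range g) ≃ₗ[R] M := hfg.linearEquivOfSurjective hf
  exact ⟨Arrow.mk ρ, ⟨cokernelIsoOfEq hρ ≪≫
    ModuleCat.cokernelIsoRangeQuotient (ModuleCat.ofHom g) ≪≫ e.toModuleIso⟩⟩

theorem essImage_cokernelOfMap_rowVectors :
    (FreydCategory.cokernelOfMap (rowVectors R)).essImage =
      fun M : ModuleCat.{u} R => Module.FinitePresentation R M := by
  ext M
  constructor
  · rintro ⟨a, ⟨e⟩⟩
    have := finitePresentation_cokernelOfMap_rowVectors a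
    exact Module.FinitePresentation.of_equiv e.toLinearEquiv
  · intro _
    exact essImage_cokernelOfMap_rowVectors_of_finitePresentation M

end RingAsCategory

theorem mainTheorem9 (R : Type u) [Ring R] :
    Nonempty (FPModuleCat R ≌ FreydCategory (AdditiveClosure (RingAsCategory R))) ∧
    Nonempty (FPFunctorCat (FPModuleCat R) ≌
      FreydCategory (FreydCategory (AdditiveClosure (RingAsCategory R)))ᵒᵖ) := by
  let L : FreydCategory (AdditiveClosure (RingAsCategory R)) ⥤ FPModuleCat R :=
    FreydCategory.liftCokernelFullSubcategory (RingAsCategory.rowVectors R) _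
      RingAsCategory.essImage_cokernelOfMap_rowVectors
  exact ⟨⟨L.asEquivalence.symm⟩,
    ⟨FPFunctorCat.equivFreydCategory.trans (FreydCategory.congr L.op).symm⟩⟩
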